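/- Let $1<p<\infty$ and let $G$ be a finitely generated infinite nilpotent group. Let $l^p(G)$ be the Banach space of $p$-summable functions $f:G\to\mathbb C$, regarded as a left $\mathbb Z[G]$-module through $(g\cdot f)(x)=f(g^{-1}x)$. For a projective resolution $\cdots\to F_2\xrightarrow{\partial_2}F_1\xrightarrow{\partial_1}F_0\to\mathbb Z\to 0$ of the trivial module $\mathbb Z$ over $\mathbb Z[G]$, put $\partial_0=0$ on $F_0$. Let $\partial_i\otimes 1$ be the induced maps on $F_i\otimes_{\mathbb Z[G]}l^p(G)$ (where $F_i$ is a right module through $m\cdot g=g^{-1}m$), and let $\widetilde\partial_i(\varphi)=\varphi\circ\partial_i$ be the induced maps $\operatorname{Hom}_{\mathbb Z[G]}(F_{i-1},l^p(G))\to\operatorname{Hom}_{\mathbb Z[G]}(F_i,l^p(G))$ for $i\ge 1$, with $\widetilde\partial_0=0$. If $F_i$ is finitely generated, by $x_1,\dots,x_n$ say, then $F_i\otimes_{\mathbb Z[G]}l^p(G)$ carries the quotient topology of the surjection $l^p(G)^n\to F_i\otimes_{\mathbb Z[G]}l^p(G)$, $(f_j)\mapsto\sum_j x_j\otimes f_j$,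 and $\operatorname{Hom}_{\mathbb Z[G]}(F_i,l^p(G))$ carries the subspace topology of the injection $\varphi\mapsto(\varphi(x_j))_j$ into $l^p(G)^n$; neither depends on the generators. In this case the reduced $l^p$-homology and $l^p$-cohomology in degree $i$ are $$\overline{H_i^{(p)}(G)}=\ker(\partial_i\otimes 1)\big/\overline{\operatorname{im}(\partial_{i+1}\otimes 1)},\qquad \overline{H^i_{(p)}(G)}=\ker(\widetilde\partial_{i+1})\big/\overline{\operatorname{im}(\widetilde\partial_i)}.$$ Then $\mathbb Z$ has a projective resolution over $\mathbb Z[G]$ all of whose modules are finitely generated, and for every projective resolution $(F_j)_{j\geq 0}$ of $\mathbb Z$ over $\mathbb Z[G]$ and every $i\ge 0$ such that $F_i$ is finitely generated, $$\overline{H_i^{(p)}(G)}=0\qquad\text{and}\qquad\overline{H^i_{(p)}(G)}=0.$$ -/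

import Mathlib

open scoped TensorProduct ENNReal
open CategoryTheory

universe u v

/-- The integral group ring `ℤ[G]`. -/
abbrev ZGroupRing (G : Type u) [Group G] : Type u := MonoidAlgebra ℤ G

/-- The abelian group `ℤ`, lifted to the universe of `G`, as a carrier for the trivial
`ℤ[G]`-module. -/
def TrivialZ (G : Type u) [Group G] : Type u := ULift.{u} ℤ

instance (G : Type u) [Group G] : AddCommGroup (TrivialZ G) :=
  inferInstanceAs (AddCommGroup (ULift.{u} ℤ))

/-- The trivial `ℤ[G]`-module `ℤ`: every element of `G` acts as the identity. -/
noncomputable instance (G : Type u) [Group G] : Module (ZGroupRing G) (TrivialZ G) :=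
  Module.compHom (TrivialZ G)
    (MonoidAlgebra.lift ℤ (Module.End ℤ (TrivialZ G)) G 1).toRingHom

/-- Projective resolutions `⋯ → F₁ → F₀ → ℤ → 0` of the trivial module `ℤ` over `ℤ[G]`. -/
abbrev GroupResolution (G : Type u) [Group G] : Type (u + 1) :=
  ProjectiveResolution (ModuleCat.of (ZGroupRing G) (TrivialZ G))

namespace LpHomology

/-- The Banach space `l^p(G)` of `p`-summable complex functions on `G`. -/
abbrev LpGroup (p : ℝ≥0∞) (G : Type u) : Type u := lp (fun _ : G => ℂ) p

section Translation

variable (p : ℝ≥0∞) [Fact (1 ≤ p)] (G : Type u) [Group G]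

theorem memℓp_translate (g : G) (f : LpGroup p G) :
    Memℓp (fun x : G => f (g⁻¹ * x)) p := by
  have hf := lp.memℓp f
  have hp : p ≠ 0 := (zero_lt_one.trans_le (Fact.out : 1 ≤ p)).ne'
  rcases eq_or_ne p ∞ with rfl | h
  · rw [memℓp_infty_iff] at hf ⊢
    refine hf.mono ?_
    rintro _ ⟨x, rfl⟩
    exact ⟨g⁻¹ * x, rfl⟩
  · have hp' : 0 < p.toReal := ENNReal.toReal_pos hp h
    rw [memℓp_gen_iff hp'] at hf ⊢
    exact (Equiv.mulLeft g⁻¹).summable_iff.mpr hf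

/-- The left translation action of `G` on `l^p(G)`: `(g • f)(x) = f (g⁻¹ x)`; on formal sums,
`g • ∑ f_h h = ∑ f_h gh`. -/
noncomputable def translation : Representation ℤ G (LpGroup p G) where
  toFun g := AddMonoidHom.toIntLinearMap
    { toFun := fun f => ⟨fun x => f (g⁻¹ * x), memℓp_translate p G g f⟩
      map_zero' := rfl
      map_add' := fun _ _ => rfl }
  map_one' := by
    ext f x
    exact congrArg f (by simp)
  map_mul' g h := by
    ext f x
    exact congrArg f (by simp [mul_assoc])

/-- `l^p(G)` as a `ℤ[G]`-module, through left translation. -/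
noncomputable instance : Module (ZGroupRing G) (LpGroup p G) :=
  Module.compHom (LpGroup p G)
    (MonoidAlgebra.lift ℤ (Module.End ℤ (LpGroup p G)) G (translation p G)).toRingHom

end Translation

section Functors

variable (p : ℝ≥0∞) [Fact (1 ≤ p)] (G : Type u) [Group G]
variable (M : Type v) [AddCommGroup M] [Module (ZGroupRing G) M]

/-- The relations `g m ⊗ g f = m ⊗ f` that define `M ⊗_{ℤ[G]} l^p(G)` as a quotient of
`M ⊗_ℤ l^p(G)`. The left module `M` is made a right module by `m g = g⁻¹ m`, so that these are the
usual relations `m g ⊗ f = m ⊗ g f`. -/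
noncomputable def tensorRelations : AddSubgroup (M ⊗[ℤ] LpGroup p G) :=
  AddSubgroup.closure {z | ∃ (g : G) (m : M) (f : LpGroup p G),
    z = (MonoidAlgebra.of ℤ G g • m) ⊗ₜ[ℤ] (MonoidAlgebra.of ℤ G g • f) - m ⊗ₜ[ℤ] f}

/-- The abelian group `M ⊗_{ℤ[G]} l^p(G)`. -/
def LpTensor : Type (max u v) := (M ⊗[ℤ] LpGroup p G) ⧸ tensorRelations p G M

noncomputable instance : AddCommGroup (LpTensor p G M) :=
  inferInstanceAs (AddCommGroup ((M ⊗[ℤ] LpGroup p G) ⧸ tensorRelations p G M))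

variable {G M} in
/-- The map `f ↦ m ⊗ f` from `l^p(G)` to `M ⊗_{ℤ[G]} l^p(G)`. -/
noncomputable def tmul (m : M) : LpGroup p G →+ LpTensor p G M :=
  (QuotientAddGroup.mk' (tensorRelations p G M)).comp
    (TensorProduct.mk ℤ M (LpGroup p G) m).toAddMonoidHom

/-- The group topology of `M ⊗_{ℤ[G]} l^p(G)`: the finest one for which all the maps `f ↦ m ⊗ f`
are continuous on the Banach space `l^p(G)`. If `M` is finitely generated, this is the quotient
topology of any map `l^p(G)^n → M ⊗_{ℤ[G]} l^p(G)` given by a finite family of generators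
(`isQuotientMap_sum_tmul`); it is thus the topology of the natural norm. -/
noncomputable def tensorTopology : AddGroupTopology (LpTensor p G M) :=
  sInf {t | ∀ m : M, @Continuous _ _ _ t.toTopologicalSpace (tmul p m)}

noncomputable instance : TopologicalSpace (LpTensor p G M) :=
  (tensorTopology p G M).toTopologicalSpace

instance : IsTopologicalAddGroup (LpTensor p G M) :=
  (tensorTopology p G M).toIsTopologicalAddGroup

/-- The abelian group `Hom_{ℤ[G]}(M, l^p(G))`. -/
abbrev LpHom : Type (max u v) := M →ₗ[ZGroupRing G] LpGroup p G

/-- The topology of `Hom_{ℤ[G]}(M, l^p(G))`: norm convergence in `l^p(G)` at each element of `M`.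
If `M` is finitely generated, this is the subspace topology of `l^p(G)^n` under evaluation at any
finite family of generators (`isInducing_eval`); it is thus the topology of the natural norm. -/
noncomputable instance : TopologicalSpace (LpHom p G M) :=
  TopologicalSpace.induced (fun (φ : LpHom p G M) (m : M) => φ m) inferInstance

instance : IsTopologicalAddGroup (LpHom p G M) :=
  topologicalAddGroup_induced
    ({ toFun := fun φ m => φ m
       map_zero' := rfl
       map_add' := fun _ _ => rfl } : LpHom p G M →+ (M → LpGroup p G))

variable {G M} {N : Type v} [AddCommGroup N] [Module (ZGroupRing G) N]

/-- The map `∂ ⊗ 1 : M ⊗_{ℤ[G]} l^p(G) → N ⊗_{ℤ[G]} l^p(G)` induced by `∂ : M → N`. -/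
noncomputable def tensorMap (d : M →ₗ[ZGroupRing G] N) : LpTensor p G M →+ LpTensor p G N :=
  QuotientAddGroup.map (tensorRelations p G M) (tensorRelations p G N)
    (TensorProduct.map d.toAddMonoidHom.toIntLinearMap LinearMap.id).toAddMonoidHom (by
      refine (AddSubgroup.closure_le _).mpr ?_
      rintro _ ⟨g, m, f, rfl⟩
      refine AddSubgroup.subset_closure ⟨g, d m, f, ?_⟩
      simp [-MonoidAlgebra.of_apply])

/-- The map `φ ↦ φ ∘ ∂` from `Hom_{ℤ[G]}(N, l^p(G))` to `Hom_{ℤ[G]}(M, l^p(G))` induced by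
`∂ : M → N`. -/
noncomputable def homMap (d : M →ₗ[ZGroupRing G] N) : LpHom p G N →+ LpHom p G M where
  toFun φ := φ.comp d
  map_zero' := rfl
  map_add' _ _ := rfl

end Functors

section Topology

variable {p : ℝ≥0∞} [Fact (1 ≤ p)] {G : Type u} [Group G]

theorem single_smul (g : G) (n : ℤ) (f : LpGroup p G) :
    (MonoidAlgebra.single g n : ZGroupRing G) • f = n • translation p G g f := by
  change (MonoidAlgebra.lift ℤ (Module.End ℤ (LpGroup p G)) G (translation p G)
    (MonoidAlgebra.single g n)) f = _
  rw [MonoidAlgebra.lift_single]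
  rfl

theorem norm_translation (g : G) (f : LpGroup p G) : ‖translation p G g f‖ = ‖f‖ := by
  have hp : p ≠ 0 := (zero_lt_one.trans_le (Fact.out : 1 ≤ p)).ne'
  rcases eq_or_ne p ∞ with rfl | h
  · rw [lp.norm_eq_ciSup, lp.norm_eq_ciSup]
    exact (Equiv.mulLeft g⁻¹).iSup_congr fun _ => rfl
  · have hp' : 0 < p.toReal := ENNReal.toReal_pos hp h
    rw [lp.norm_eq_tsum_rpow hp', lp.norm_eq_tsum_rpow hp']
    congr 1
    exact (Equiv.mulLeft g⁻¹).tsum_eq fun x => ‖f x‖ ^ p.toReal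

theorem continuous_smul (r : ZGroupRing G) : Continuous fun f : LpGroup p G => r • f := by
  induction r using MonoidAlgebra.induction_linear with
  | zero => simpa using continuous_const
  | add r s hr hs => simp only [add_smul]; exact hr.add hs
  | single g n =>
    simp only [single_smul]
    have : Continuous (translation p G g) :=
      AddMonoidHomClass.continuous_of_bound (translation p G g) 1 fun f => by
        rw [norm_translation, one_mul]
    exact this.zsmul n

variable {M : Type v} [AddCommGroup M] [Module (ZGroupRing G) M]

/-- On a finitely generated module, the topology of `Hom_{ℤ[G]}(M, l^p(G))` is that of a subspace of
`l^p(G)^n`. -/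
theorem isInducing_eval {ι : Type*} [Fintype ι] (x : ι → M)
    (hx : Submodule.span (ZGroupRing G) (Set.range x) = ⊤) :
    Topology.IsInducing fun (φ : LpHom p G M) (i : ι) => φ (x i) := by
  refine ⟨le_antisymm ?_ ?_⟩
  · rw [← continuous_iff_le_induced, continuous_pi_iff]
    exact fun i => (continuous_apply (x i)).comp continuous_induced_dom
  · let t : TopologicalSpace (LpHom p G M) :=
      TopologicalSpace.induced (fun φ i => φ (x i)) inferInstance
    have ht : @Continuous _ _ t _ fun (φ : LpHom p G M) (i : ι) => φ (x i) :=
      continuous_induced_dom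
    refine continuous_iff_le_induced.mp (continuous_pi fun m => ?_)
    have hm : m ∈ Submodule.span (ZGroupRing G) (Set.range x) := hx ▸ Submodule.mem_top
    obtain ⟨c, rfl⟩ := (Submodule.mem_span_range_iff_exists_fun _).mp hm
    simp only [map_sum, map_smul]
    exact continuous_finsetSum _ fun i _ =>
      (continuous_smul (c i)).comp ((continuous_apply i).comp ht)

theorem continuous_tmul (m : M) : Continuous (tmul p m : LpGroup p G → LpTensor p G M) := by
  change @Continuous _ _ _ (tensorTopology p G M).toTopologicalSpace _
  rw [tensorTopology, AddGroupTopology.toTopologicalSpace_sInf, continuous_sInf_rng]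
  rintro _ ⟨t, ht, rfl⟩
  exact ht m

theorem tmul_of_smul (g : G) (m : M) (f : LpGroup p G) :
    tmul p (MonoidAlgebra.of ℤ G g • m) f = tmul p m (MonoidAlgebra.of ℤ G g⁻¹ • f) := by
  refine (QuotientAddGroup.eq_iff_sub_mem).mpr (AddSubgroup.subset_closure
    ⟨g, m, MonoidAlgebra.of ℤ G g⁻¹ • f, ?_⟩)
  rw [smul_smul, ← map_mul, mul_inv_cancel, map_one, one_smul]
  rfl

theorem tmul_add_left (m m' : M) (f : LpGroup p G) :
    tmul p (m + m') f = tmul p m f + tmul p m' f :=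
  congrArg (QuotientAddGroup.mk' (tensorRelations p G M)) (TensorProduct.add_tmul m m' f)

theorem exists_tmul_smul (r : ZGroupRing G) (m : M) :
    ∃ s : ZGroupRing G, ∀ f : LpGroup p G, tmul p (r • m) f = tmul p m (s • f) := by
  induction r using MonoidAlgebra.induction_linear with
  | zero =>
    refine ⟨0, fun f => ?_⟩
    rw [zero_smul, zero_smul, map_zero]
    exact map_zero (AddMonoidHom.mk' (fun m : M => tmul p m f) fun m m' => tmul_add_left m m' f)
  | add r s hr hs =>
    obtain ⟨r', hr'⟩ := hr
    obtain ⟨s', hs'⟩ := hs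
    refine ⟨r' + s', fun f => ?_⟩
    rw [add_smul r' s' f, map_add, ← hr', ← hs', add_smul, tmul_add_left]
  | single g n =>
    refine ⟨n • MonoidAlgebra.of ℤ G g⁻¹, fun f => ?_⟩
    have h : (MonoidAlgebra.single g n : ZGroupRing G) = n • MonoidAlgebra.of ℤ G g := by simp
    rw [h, smul_assoc, smul_assoc, map_zsmul, ← tmul_of_smul]
    exact map_zsmul (AddMonoidHom.mk' (fun m : M => tmul p m f)
      fun m m' => tmul_add_left m m' f) n _

/-- On a finitely generated module, the topology of `M ⊗_{ℤ[G]} l^p(G)` is that of a quotient of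
`l^p(G)^n`. -/
theorem isQuotientMap_sum_tmul {ι : Type*} [Fintype ι] (x : ι → M)
    (hx : Submodule.span (ZGroupRing G) (Set.range x) = ⊤) :
    Topology.IsQuotientMap
      fun f : ι → LpGroup p G => (∑ i, tmul p (x i) (f i) : LpTensor p G M) := by
  classical
  let q : (ι → LpGroup p G) →+ LpTensor p G M :=
    AddMonoidHom.mk' (fun f => ∑ i, tmul p (x i) (f i)) fun f f' => by
      simp [Finset.sum_add_distrib]
  have hqc : Continuous q :=
    continuous_finsetSum _ fun i _ => (continuous_tmul (x i)).comp (continuous_apply i)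
  have hfac : ∀ m : M, ∃ s : ι → ZGroupRing G, ∀ f, tmul p m f = q fun i => s i • f := by
    intro m
    have hm : m ∈ Submodule.span (ZGroupRing G) (Set.range x) := hx ▸ Submodule.mem_top
    obtain ⟨c, rfl⟩ := (Submodule.mem_span_range_iff_exists_fun _).mp hm
    choose s hs using fun i => exists_tmul_smul (p := p) (c i) (x i)
    refine ⟨s, fun f => ?_⟩
    have h := map_sum (AddMonoidHom.mk' (fun m : M => tmul p m f)
      fun m m' => tmul_add_left m m' f) (fun i => c i • x i) Finset.univ
    exact h.trans (Finset.sum_congr rfl fun i _ => hs i f)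
  have hqs : Function.Surjective q := by
    rw [← AddMonoidHom.range_eq_top, eq_top_iff]
    rintro z -
    obtain ⟨z, rfl⟩ := QuotientAddGroup.mk'_surjective _ z
    induction z using TensorProduct.induction_on with
    | zero => exact zero_mem _
    | tmul m f =>
      obtain ⟨s, hs⟩ := hfac m
      exact ⟨_, (hs f).symm⟩
    | add a b ha hb => rw [map_add]; exact add_mem ha hb
  let e := QuotientAddGroup.quotientKerEquivOfSurjective q hqs
  have he : ∀ f, e.symm (q f) = QuotientAddGroup.mk f := fun f =>
    e.symm_apply_eq.mpr rfl
  let t : AddGroupTopology (LpTensor p G M) :=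
    { toTopologicalSpace := TopologicalSpace.induced e.symm inferInstance
      toIsTopologicalAddGroup := topologicalAddGroup_induced e.symm }
  have hqt : @Continuous _ _ _ t.toTopologicalSpace q := by
    refine continuous_induced_rng.mpr ?_
    have : (e.symm ∘ q) = QuotientAddGroup.mk := funext he
    rw [this]
    exact QuotientAddGroup.continuous_mk
  have hle : tensorTopology p G M ≤ t := by
    refine sInf_le fun m => ?_
    obtain ⟨s, hs⟩ := hfac m
    have : (tmul p m : LpGroup p G → LpTensor p G M) = q ∘ fun f i => s i • f := funext hs
    have hs' : Continuous fun (f : LpGroup p G) (i : ι) => s i • f :=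
      continuous_pi fun i => continuous_smul (s i)
    have hcomp : @Continuous _ _ _ t.toTopologicalSpace (q ∘ fun f i => s i • f) :=
      @Continuous.comp _ _ _ _ _ t.toTopologicalSpace _ _ hqt hs'
    exact this ▸ hcomp
  refine ⟨⟨le_antisymm (fun U hU => ?_) (continuous_iff_coinduced_le.mp hqc)⟩, hqs⟩
  refine hle U ⟨e.symm '' U, ?_, e.symm.injective.preimage_image U⟩
  have hU' : IsOpen (q ⁻¹' U) := hU
  refine (QuotientAddGroup.isOpenQuotientMap_mk (N := q.ker)).isQuotientMap.isOpen_preimage.mp ?_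
  convert hU' using 1
  ext f
  simp only [Set.mem_preimage, ← he f]
  exact e.symm.injective.mem_set_image

end Topology

section Reduced

variable (p : ℝ≥0∞) [Fact (1 ≤ p)] {G : Type u} [Group G] (F : GroupResolution G)

/-- The kernel of `∂_i ⊗ 1` on `F_i ⊗_{ℤ[G]} l^p(G)`, where `∂_0 = 0`. -/
noncomputable def cycles : (i : ℕ) → AddSubgroup (LpTensor p G (F.complex.X i))
  | 0 => ⊤
  | i + 1 => (tensorMap p (F.complex.d (i + 1) i).hom).ker

/-- The image of `∂_{i+1} ⊗ 1` in `F_i ⊗_{ℤ[G]} l^p(G)`. -/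
noncomputable def boundaries (i : ℕ) : AddSubgroup (LpTensor p G (F.complex.X i)) :=
  (tensorMap p (F.complex.d (i + 1) i).hom).range

/-- The reduced `l^p`-homology: cycles modulo the closure of the boundaries. -/
abbrev ReducedHomology (i : ℕ) : Type u :=
  cycles p F i ⧸ (boundaries p F i).topologicalClosure.addSubgroupOf (cycles p F i)

/-- The kernel of `φ ↦ φ ∘ ∂_{i+1}` on `Hom_{ℤ[G]}(F_i, l^p(G))`. -/
noncomputable def cocycles (i : ℕ) : AddSubgroup (LpHom p G (F.complex.X i)) :=
  (homMap p (F.complex.d (i + 1) i).hom).ker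

/-- The image of `φ ↦ φ ∘ ∂_i` in `Hom_{ℤ[G]}(F_i, l^p(G))`, where `∂_0 = 0`. -/
noncomputable def coboundaries : (i : ℕ) → AddSubgroup (LpHom p G (F.complex.X i))
  | 0 => ⊥
  | i + 1 => (homMap p (F.complex.d (i + 1) i).hom).range

/-- The reduced `l^p`-cohomology: cocycles modulo the closure of the coboundaries. -/
abbrev ReducedCohomology (i : ℕ) : Type u :=
  cocycles p F i ⧸ (coboundaries p F i).topologicalClosure.addSubgroupOf (cocycles p F i)

end Reduced

end LpHomology

/-!
A finitely generated infinite nilpotent group `G` has a central element `z` of infinite order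
(`Group.IsNilpotent.exists_mem_center_orderOf_eq_zero`). Since `z` is central, multiplication by `z`
is a chain map of any projective resolution `F` of `ℤ` over `ℤ[G]`; since `z` acts trivially on `ℤ`,
it is chain homotopic to the identity (`LpHomology.exists_homotopy_centralMul`). Hence `z - 1` maps
cycles of `F ⊗ l^p(G)` to boundaries, and cocycles of `Hom(F, l^p(G))` to coboundaries.

On `l^p(G)`, let `T_N` be the average of the translations by `1, z, …, z ^ (N - 1)`. It is
`ℤ[G]`-linear, of norm at most `1`, and sends a point mass of size `a` to `N` disjoint masses of size
`a / N`, of norm `N ^ (1 / p - 1) * ‖a‖`. As `1 < p < ∞`, it follows that `T_N f → 0` for all `f`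
(`LpHomology.tendsto_average`). On the other hand `1 - T_N = (1 - z) S_N` with a `ℤ[G]`-linear
operator `S_N`, so that `c - T_N c` is a boundary for each cycle `c`, and `c` is the limit of these
boundaries. The same argument applies to cocycles. Finite generation of `F_i` plays no role here: it
serves to identify the topologies on the chains and cochains.

The existence of a resolution by finitely generated projective modules follows from the theorem
that `ℤ[G]` is left Noetherian (`Group.IsNilpotent.isNoetherianRing_monoidAlgebra`). Both this
theorem and the existence of `z` are proved by climbing from the trivial subgroup to `G`, adjoining
to a normal subgroup `H` one element `t` that is central modulo `H`
(`Group.IsNilpotent.induction_sup_zpowers`). For the group ring, a step of this climb is the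
argument of the Hilbert basis theorem for Laurent polynomials in `t` with coefficients in `ℤ[H]`
(`CyclicExtension.isNoetherianRing`).
-/

open Filter Topology
open scoped commutatorElement

/-! ### Finitely generated nilpotent groups -/

namespace Subgroup

variable {G : Type*} [Group G]

theorem normal_of_commutator_mem {N K : Subgroup G} (hNK : N ≤ K)
    (h : ∀ x ∈ K, ∀ g, ⁅x, g⁆ ∈ N) : K.Normal := by
  refine ⟨fun x hx g => ?_⟩
  have h1 : g * x * g⁻¹ = ⁅x, g⁆⁻¹ * x := by
    rw [commutatorElement_def]; group
  rw [h1]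
  exact K.mul_mem (K.inv_mem (hNK (h x hx g))) hx

theorem le_upperCentralSeriesStep_lowerCentralSeries (n : ℕ) :
    (⊤ : Subgroup G).lowerCentralSeries n ≤
      upperCentralSeriesStep ((⊤ : Subgroup G).lowerCentralSeries (n + 1)) :=
  fun _ hx g => commutator_mem_commutator hx (mem_top g)

theorem upperCentralSeriesStep_mono {N K : Subgroup G} [N.Normal] [K.Normal] (h : N ≤ K) :
    upperCentralSeriesStep N ≤ upperCentralSeriesStep K :=
  fun _ hx g => h (hx g)

/-- It suffices to test centrality modulo `K` on a generating set of the group. -/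
theorem mem_upperCentralSeriesStep_of_closure_eq_top {K : Subgroup G} [K.Normal] {S : Set G}
    (hS : closure S = ⊤) {t : G} (h : ∀ s ∈ S, ⁅t, s⁆ ∈ K) : t ∈ upperCentralSeriesStep K := by
  have key : ∀ g : G, ⁅t, g⁆ ∈ K ↔ Commute (t : G ⧸ K) (g : G ⧸ K) := fun g => by
    rw [commute_iff_eq, ← commutatorElement_eq_one_iff_mul_comm, ← QuotientGroup.eq_one_iff]
    rfl
  have hle : closure S ≤ (centralizer {(t : G ⧸ K)}).comap (QuotientGroup.mk' K) := by
    rw [closure_le]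
    intro s hs
    exact mem_centralizer_singleton_iff.mpr ((key s).mp (h s hs)).symm
  intro g
  have hg : g ∈ closure S := hS ▸ mem_top g
  exact (key g).mpr (show Commute _ _ from (mem_centralizer_singleton_iff.mp (hle hg)).symm)

/-- In a finitely generated group, each factor of the lower central series is finitely
generated: commutators of generators of one factor with generators of the group generate
the next one. -/
theorem exists_finset_lowerCentralSeries_eq [hG : Group.FG G] (n : ℕ) :
    ∃ T : Finset G, (⊤ : Subgroup G).lowerCentralSeries n =
      closure (T : Set G) ⊔ (⊤ : Subgroup G).lowerCentralSeries (n + 1) := by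
  classical
  obtain ⟨S, hS⟩ := Group.fg_def.mp hG
  induction n with
  | zero => exact ⟨S, by rw [hS, top_sup_eq]; rfl⟩
  | succ n ih =>
    obtain ⟨T, hT⟩ := ih
    set γ := (⊤ : Subgroup G).lowerCentralSeries
    let T' : Finset G := (T ×ˢ S).image fun x => ⁅x.1, x.2⁆
    refine ⟨T', ?_⟩
    have hTγ : ∀ t ∈ T, t ∈ γ n := fun t ht => hT ▸ mem_sup_left (subset_closure ht)
    have hKγ : closure (T' : Set G) ⊔ γ (n + 1 + 1) ≤ γ (n + 1) := by
      refine sup_le ((closure_le _).mpr ?_) ((⊤ : Subgroup G).lowerCentralSeries_antitone (by lia))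
      intro x hx
      obtain ⟨⟨t, s⟩, hts, rfl⟩ := Finset.mem_image.mp (Finset.mem_coe.mp hx)
      exact le_upperCentralSeriesStep_lowerCentralSeries n
        (hTγ t (Finset.mem_product.mp hts).1) s
    have hKn : (closure (T' : Set G) ⊔ γ (n + 1 + 1)).Normal :=
      normal_of_commutator_mem le_sup_right fun x hx =>
        le_upperCentralSeriesStep_lowerCentralSeries (n + 1) (hKγ hx)
    refine le_antisymm ?_ hKγ
    have hle : γ n ≤ upperCentralSeriesStep (closure (T' : Set G) ⊔ γ (n + 1 + 1)) := by
      rw [hT]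
      refine sup_le ((closure_le _).mpr fun t ht => ?_)
        ((le_upperCentralSeriesStep_lowerCentralSeries (n + 1)).trans
          (upperCentralSeriesStep_mono le_sup_right))
      refine mem_upperCentralSeriesStep_of_closure_eq_top hS fun s hs =>
        mem_sup_left (subset_closure ?_)
      exact Finset.mem_coe.mpr (Finset.mem_image.mpr ⟨(t, s), Finset.mem_product.mpr ⟨ht, hs⟩, rfl⟩)
    exact commutator_le.mpr fun x hx g _ => hle hx g

end Subgroup

open Subgroup in
/-- A finitely generated nilpotent group is reached from the trivial subgroup by successively
adjoining to a normal subgroup `H` an element that is central modulo `H`. -/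
theorem Group.IsNilpotent.induction_sup_zpowers {G : Type*} [Group G] [Group.FG G]
    [hG : Group.IsNilpotent G] {P : Subgroup G → Prop} (bot : P ⊥)
    (sup_zpowers : ∀ H : Subgroup G, H.Normal → ∀ t : G, (∀ g, ⁅t, g⁆ ∈ H) → P H →
      P (H ⊔ zpowers t)) : P ⊤ := by
  classical
  obtain ⟨c, hc⟩ := Subgroup.nilpotent_iff_lowerCentralSeries.mp hG
  suffices h : ∀ k n, n + k = c → P ((⊤ : Subgroup G).lowerCentralSeries n) from h c 0 (zero_add c)
  intro k
  induction k with
  | zero => rintro n rfl; exact (show _ = _ from hc) ▸ bot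
  | succ k ih =>
    intro n hn
    obtain ⟨T, hT⟩ := exists_finset_lowerCentralSeries_eq (G := G) n
    suffices h : ∀ U : Finset G, (U : Set G) ⊆ (⊤ : Subgroup G).lowerCentralSeries n →
        P (closure (U : Set G) ⊔ (⊤ : Subgroup G).lowerCentralSeries (n + 1)) from
      hT ▸ h T fun t ht => hT ▸ mem_sup_left (subset_closure ht)
    intro U
    induction U using Finset.induction_on with
    | empty =>
      intro _
      rw [Finset.coe_empty, Subgroup.closure_empty, bot_sup_eq]
      exact ih (n + 1) (by lia)
    | insert t U _ ihU =>
      intro hU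
      rw [Finset.coe_insert, Set.insert_subset_iff] at hU
      rw [Finset.coe_insert, Set.insert_eq, Subgroup.closure_union, ← zpowers_eq_closure, sup_assoc,
        sup_comm]
      have hle := sup_le ((closure_le _).mpr hU.2)
        ((⊤ : Subgroup G).lowerCentralSeries_antitone n.le_succ)
      exact sup_zpowers _ (normal_of_commutator_mem le_sup_right fun x hx =>
        le_upperCentralSeriesStep_lowerCentralSeries n (hle hx)) t
        (fun g => mem_sup_right (le_upperCentralSeriesStep_lowerCentralSeries n hU.1 g))
        (ihU hU.2)

open Subgroup in
/-- If `t` has infinite order and its commutators lie in the finite normal subgroup `H`, then a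
power `u` of `t` centralizes `H`; conjugation multiplies `u` by elements of `H` commuting with `u`,
hence fixes `u ^ |H|`. -/
theorem exists_mem_center_orderOf_eq_zero {G : Type*} [Group G] {H : Subgroup G} [H.Normal]
    [Finite H] {t : G} (ht : orderOf t = 0) (h : ∀ g, ⁅t, g⁆ ∈ H) :
    ∃ z ∈ center G, orderOf z = 0 := by
  set a := Nat.card (Equiv.Perm H)
  set m := Nat.card H
  have ha : a ≠ 0 := Nat.card_pos.ne'
  have hm : m ≠ 0 := Nat.card_pos.ne'
  -- Conjugation by `t` is a permutation of `H`, so its power with exponent `a` is the identity.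
  have hcomm : ∀ x ∈ H, Commute x (t ^ a) := by
    intro x hx
    have h1 : (MulAction.toPermHom (MulAut H) H (MulAut.conjNormal t)) ^ a = 1 := pow_card_eq_one'
    rw [← map_pow, ← map_pow] at h1
    have h2 := congrArg (fun e : Equiv.Perm H => ((e ⟨x, hx⟩ : H) : G)) h1
    simp only [MulAction.toPermHom_apply, MulAction.toPerm_apply, MulAut.smul_def,
      MulAut.conjNormal_apply, Equiv.Perm.coe_one, id_eq] at h2
    exact (eq_mul_inv_iff_mul_eq.mp h2.symm)
  have hconj : ∀ g, ∃ k ∈ H, g * t ^ a * g⁻¹ = k * t ^ a := by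
    intro g
    refine ⟨⁅g, t ^ a⁆, ?_, by simp [commutatorElement_def]⟩
    have h1 : t ∈ H.upperCentralSeriesStep := h
    rw [← commutatorElement_inv]
    exact H.inv_mem (pow_mem h1 a g)
  refine ⟨(t ^ a) ^ m, mem_center_iff.mpr fun g => ?_, ?_⟩
  · obtain ⟨k, hk, hgk⟩ := hconj g
    have hkm : k ^ m = 1 := by
      exact congrArg Subtype.val (pow_card_eq_one' (x := (⟨k, hk⟩ : H)))
    have : g * (t ^ a) ^ m * g⁻¹ = (t ^ a) ^ m := by
      rw [← conj_pow, hgk, (hcomm k hk).mul_pow, hkm, one_mul]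
    exact mul_inv_eq_iff_eq_mul.mp this
  · rw [← pow_mul, orderOf_eq_zero_iff] 
    exact fun hf => orderOf_eq_zero_iff.mp ht (hf.of_pow (mul_ne_zero ha hm))

open Subgroup in
/-- A finitely generated infinite nilpotent group has a central element of infinite order. -/
theorem Group.IsNilpotent.exists_mem_center_orderOf_eq_zero (G : Type*) [Group G] [Group.FG G]
    [Group.IsNilpotent G] [Infinite G] : ∃ z ∈ center G, orderOf z = 0 := by
  by_contra hz
  have hfin : Finite (⊤ : Subgroup G) := by
    refine Group.IsNilpotent.induction_sup_zpowers (P := fun H => Finite H) inferInstance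
      fun H _ t ht _ => ?_
    have : Finite (zpowers t) := by
      refine Set.finite_coe_iff.mpr (finite_zpowers.mpr ?_)
      by_contra h
      exact hz (_root_.exists_mem_center_orderOf_eq_zero (orderOf_eq_zero_iff.mpr h) ht)
    refine Set.Finite.subset (Set.Finite.mul (H : Set G).toFinite (zpowers t : Set G).toFinite) ?_
    intro x hx
    obtain ⟨y, hy, w, hw, rfl⟩ := mem_sup_of_normal_left.mp hx
    exact Set.mul_mem_mul hy hw
  exact (Finite.of_equiv _ Subgroup.topEquiv.toEquiv : Finite G).false

/-! ### Laurent polynomials over a Noetherian ring -/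

namespace CyclicExtension

variable {A B : Type*} [Ring A] [Ring B] (φ : B →+* A) (t : Aˣ)

/-- The additive group of polynomials `∑ t ^ k * φ b_k` with `k < n`. -/
def degreeLT : ℕ → AddSubgroup A
  | 0 => ⊥
  | n + 1 => degreeLT n ⊔ ((AddMonoidHom.mulLeft ((t : A) ^ n)).comp φ.toAddMonoidHom).range

variable {φ t}

theorem mem_degreeLT_succ {n : ℕ} {x : A} :
    x ∈ degreeLT φ t (n + 1) ↔ ∃ y ∈ degreeLT φ t n, ∃ b, y + (t : A) ^ n * φ b = x := by
  simp [degreeLT, AddSubgroup.mem_sup]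

theorem degreeLT_mono : Monotone (degreeLT φ t) :=
  monotone_nat_of_le_succ fun _ => le_sup_left

theorem mul_mem_degreeLT {n : ℕ} {x : A} (hx : x ∈ degreeLT φ t n) :
    (t : A) * x ∈ degreeLT φ t (n + 1) := by
  induction n generalizing x with
  | zero =>
    obtain rfl : x = 0 := hx
    rw [mul_zero]
    exact zero_mem _
  | succ n ih =>
    obtain ⟨y, hy, b, rfl⟩ := mem_degreeLT_succ.mp hx
    exact mem_degreeLT_succ.mpr ⟨_, ih hy, b, by rw [mul_add, pow_succ', mul_assoc]⟩

theorem pow_mul_mem_degreeLT {n : ℕ} {x : A} (hx : x ∈ degreeLT φ t n) (k : ℕ) :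
    (t : A) ^ k * x ∈ degreeLT φ t (n + k) := by
  induction k with
  | zero => simpa using hx
  | succ k ih =>
    rw [pow_succ', mul_assoc]
    exact mul_mem_degreeLT ih

section

variable {σ : B ≃+* B} (hσ : ∀ b, φ (σ b) * t = t * φ b)
include hσ

theorem map_pow_mul_pow (n : ℕ) (b : B) : φ ((σ ^ n) b) * (t : A) ^ n = (t : A) ^ n * φ b := by
  induction n generalizing b with
  | zero => simp
  | succ n ih =>
    rw [pow_succ, pow_succ, RingAut.mul_apply, ← mul_assoc, ih, mul_assoc, hσ, ← mul_assoc]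

theorem map_mul_mem_degreeLT {n : ℕ} (b : B) {x : A} (hx : x ∈ degreeLT φ t n) :
    φ b * x ∈ degreeLT φ t n := by
  induction n generalizing x with
  | zero =>
    obtain rfl : x = 0 := hx
    rw [mul_zero]
    exact zero_mem _
  | succ n ih =>
    obtain ⟨y, hy, c, rfl⟩ := mem_degreeLT_succ.mp hx
    refine mem_degreeLT_succ.mpr ⟨_, ih hy, (σ ^ n)⁻¹ b * c, ?_⟩
    rw [mul_add, ← mul_assoc (φ b), map_mul, ← mul_assoc, ← map_pow_mul_pow hσ, RingAut.inv_apply,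
      RingEquiv.apply_symm_apply]

end

variable {σ : B ≃+* B} (hσ : ∀ b, φ (σ b) * t = t * φ b)

/-- The left ideal of coefficients `b` of `t ^ n` in the elements `y + t ^ n * φ b` of `I` with `y`
of degree less than `n`. -/
def leadingCoeff (I : Submodule A A) (n : ℕ) : Submodule B B where
  carrier := {b | ∃ y ∈ degreeLT φ t n, y + (t : A) ^ n * φ b ∈ I}
  zero_mem' := ⟨0, zero_mem _, by simp⟩
  add_mem' := by
    rintro b c ⟨y, hy, hb⟩ ⟨z, hz, hc⟩
    refine ⟨y + z, add_mem hy hz, ?_⟩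
    rw [map_add, mul_add, add_add_add_comm]
    exact add_mem hb hc
  smul_mem' := by
    rintro c b ⟨y, hy, hb⟩
    refine ⟨φ ((σ ^ n) c) * y, map_mul_mem_degreeLT hσ _ hy, ?_⟩
    have := I.smul_mem (φ ((σ ^ n) c)) hb
    rwa [smul_eq_mul, mul_add, ← mul_assoc _ (_ ^ n), map_pow_mul_pow hσ, mul_assoc,
      ← map_mul] at this

theorem leadingCoeff_mono_left (n : ℕ) : Monotone fun I => leadingCoeff hσ I n :=
  fun _ _ h _ ⟨y, hy, hb⟩ => ⟨y, hy, h hb⟩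

theorem leadingCoeff_mono_right (I : Submodule A A) : Monotone (leadingCoeff hσ I) := by
  refine monotone_nat_of_le_succ fun n => ?_
  rintro b ⟨y, hy, hb⟩
  refine ⟨t * y, mul_mem_degreeLT hy, ?_⟩
  have := I.smul_mem (t : A) hb
  rwa [smul_eq_mul, mul_add, ← mul_assoc, ← pow_succ'] at this

/-- Left ideals `I ≤ J` with the same leading coefficients in all degrees agree: every element of
`A` becomes a polynomial after multiplication by a power of the unit `t`, and the degree of a
polynomial in `J` can be lowered by subtracting an element of `I`. -/
theorem eq_of_leadingCoeff_eq (hA : ∀ x : A, ∃ k n : ℕ, (t : A) ^ k * x ∈ degreeLT φ t n)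
    {I J : Submodule A A} (hIJ : I ≤ J) (h : ∀ n, leadingCoeff hσ I n = leadingCoeff hσ J n) :
    I = J := by
  have key : ∀ n, ∀ x ∈ degreeLT φ t n, x ∈ J → x ∈ I := by
    intro n
    induction n with
    | zero =>
      intro x hx _
      obtain rfl : x = 0 := hx
      exact zero_mem _
    | succ n ih =>
      intro x hx hxJ
      obtain ⟨y, hy, b, rfl⟩ := mem_degreeLT_succ.mp hx
      have hb : b ∈ leadingCoeff hσ I n := h n ▸ ⟨y, hy, hxJ⟩
      obtain ⟨z, hz, hzI⟩ := hb
      have h1 : y - z ∈ I := by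
        refine ih _ (sub_mem hy hz) ?_
        rw [← add_sub_add_right_eq_sub y z ((t : A) ^ n * φ b)]
        exact sub_mem hxJ (hIJ hzI)
      rw [← sub_add_cancel y z, add_assoc]
      exact add_mem h1 hzI
  refine le_antisymm hIJ fun x hx => ?_
  obtain ⟨k, n, hkn⟩ := hA x
  have h1 := I.smul_mem ((t⁻¹ ^ k : Aˣ) : A) (key n _ hkn (J.smul_mem _ hx))
  rwa [smul_eq_mul, ← mul_assoc, ← Units.val_pow_eq_pow_val, ← Units.val_mul, inv_pow,
    inv_mul_cancel, Units.val_one, one_mul] at h1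

include hσ in
/-- A form of the Hilbert basis theorem: a ring is left Noetherian if it consists of the Laurent
polynomials in a unit `t` over a left Noetherian ring whose elements can be moved past `t` by means
of an automorphism `σ`. No freeness is assumed, so that `t` may have finite order modulo the
coefficients. -/
theorem isNoetherianRing [IsNoetherianRing B]
    (hA : ∀ x : A, ∃ k n : ℕ, (t : A) ^ k * x ∈ degreeLT φ t n) : IsNoetherianRing A := by
  rw [isNoetherianRing_iff, ← monotone_stabilizes_iff_noetherian]
  intro I
  have stab := monotone_stabilizes_iff_noetherian.mpr ‹IsNoetherianRing B›
  have mono : ∀ {i j m n : ℕ}, i ≤ j → m ≤ n →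
      leadingCoeff hσ (I i) m ≤ leadingCoeff hσ (I j) n := fun hij hmn =>
    (leadingCoeff_mono_left hσ _ (I.monotone hij)).trans (leadingCoeff_mono_right hσ _ hmn)
  -- The diagonal settles the degrees `n ≥ N`; each of the finitely many others settles on its own.
  obtain ⟨N, hN⟩ := stab ⟨fun i => leadingCoeff hσ (I i) i, fun _ _ h => mono h h⟩
  choose K hK using fun n =>
    stab ⟨fun i => leadingCoeff hσ (I i) n, fun _ _ h => mono h le_rfl⟩
  refine ⟨max N ((Finset.range N).sup K), fun i hi => eq_of_leadingCoeff_eq hσ hA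
    (I.monotone hi) fun n => ?_⟩
  rcases lt_or_ge n N with hn | hn
  · have h1 : K n ≤ max N ((Finset.range N).sup K) :=
      (Finset.le_sup (f := K) (Finset.mem_range.mpr hn)).trans (le_max_right _ _)
    exact (hK n _ h1).symm.trans (hK n _ (h1.trans hi))
  · refine le_antisymm (mono hi le_rfl) ?_
    calc leadingCoeff hσ (I i) n ≤ leadingCoeff hσ (I (max i n)) (max i n) :=
          mono (le_max_left _ _) (le_max_right _ _)
      _ = leadingCoeff hσ (I N) N := (hN _ (hn.trans (le_max_right _ _))).symm
      _ ≤ _ := mono (le_max_left _ _) hn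

end CyclicExtension

namespace MonoidAlgebra

variable {R K L : Type*} [CommRing R] [Group K] [Group L]

open CyclicExtension in
/-- The group ring of an extension of (an image of) `K` by the cyclic group generated by `t` is left
Noetherian if the one of `K` is. -/
theorem isNoetherianRing_of_cyclic_extension [IsNoetherianRing (MonoidAlgebra R K)] (f : K →* L)
    (t : L) (α : K ≃* K) (hα : ∀ k, f (α k) * t = t * f k)
    (hL : ∀ x : L, ∃ (n : ℤ) (k : K), x = t ^ n * f k) : IsNoetherianRing (MonoidAlgebra R L) := by
  let φ : MonoidAlgebra R K →+* MonoidAlgebra R L := mapDomainRingHom R f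
  let T : (MonoidAlgebra R L)ˣ := (toUnits t).map (of R L)
  have hT : ∀ n : ℕ, (T : MonoidAlgebra R L) ^ n = single (t ^ n) 1 := fun n => by
    change (of R L t) ^ n = _
    rw [← map_pow, of_apply]
  have hT1 : (T : MonoidAlgebra R L) = single t 1 := rfl
  refine isNoetherianRing (φ := φ) (t := T) (σ := mapDomainRingEquiv R α) (fun b => ?_)
    fun x => ?_
  · induction b using MonoidAlgebra.induction_linear with
    | zero => simp
    | add x y hx hy => simp only [map_add, add_mul, mul_add, hx, hy]
    | single k r => simp [φ, hT1, hα]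
  · induction x using MonoidAlgebra.induction_linear with
    | zero => exact ⟨0, 0, by simp [degreeLT]⟩
    | add x y hx hy =>
      obtain ⟨k, m, hx⟩ := hx
      obtain ⟨l, n, hy⟩ := hy
      refine ⟨l + k, max (m + l) (n + k), ?_⟩
      rw [mul_add]
      refine add_mem (degreeLT_mono (le_max_left _ _) ?_) (degreeLT_mono (le_max_right _ _) ?_)
      · rw [pow_add, mul_assoc]
        exact pow_mul_mem_degreeLT hx l
      · rw [add_comm l k, pow_add, mul_assoc]
        exact pow_mul_mem_degreeLT hy k
    | single x r =>
      obtain ⟨n, k, rfl⟩ := hL x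
      -- Multiplication by `t ^ |n|` clears a negative exponent `n`.
      refine ⟨n.natAbs, (n.natAbs + n).toNat + 1, mem_degreeLT_succ.mpr
        ⟨0, zero_mem _, single k r, ?_⟩⟩
      rw [hT, hT, zero_add]
      have h1 : φ (single k r) = single (f k) r := by simp [φ]
      rw [h1, single_mul_single, single_mul_single, one_mul, ← mul_assoc, ← zpow_natCast t,
        ← zpow_natCast t, ← zpow_add, Int.toNat_of_nonneg (by lia)]

end MonoidAlgebra

/-! ### The group ring of a nilpotent group -/

open Subgroup in
/-- Hall's theorem for nilpotent groups: the integral group ring of a finitely generated nilpotent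
group is left Noetherian. -/
theorem Group.IsNilpotent.isNoetherianRing_monoidAlgebra (G : Type*) [Group G] [Group.FG G]
    [Group.IsNilpotent G] : IsNoetherianRing (MonoidAlgebra ℤ G) := by
  have h : IsNoetherianRing (MonoidAlgebra ℤ (⊤ : Subgroup G)) := by
    refine Group.IsNilpotent.induction_sup_zpowers
      (P := fun H => IsNoetherianRing (MonoidAlgebra ℤ H)) ?_ fun H _ t _ _ => ?_
    · refine isNoetherianRing_of_surjective ℤ _ (Int.castRingHom _) fun x => ?_
      induction x using MonoidAlgebra.induction_linear with
      | zero => exact ⟨0, map_zero _⟩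
      | add x y hx hy =>
        obtain ⟨a, rfl⟩ := hx
        obtain ⟨b, rfl⟩ := hy
        exact ⟨a + b, map_add _ _ _⟩
      | single m r => exact ⟨r, by rw [Subsingleton.elim m 1]; simp [MonoidAlgebra.intCast_def]⟩
    · refine MonoidAlgebra.isNoetherianRing_of_cyclic_extension
        (inclusion (le_sup_left : H ≤ H ⊔ zpowers t))
        ⟨t, mem_sup_right (mem_zpowers t)⟩ (MulAut.conjNormal t) (fun k => ?_) fun x => ?_
      · ext
        simp
      · obtain ⟨x, hx⟩ := x
        rw [sup_comm] at hx
        obtain ⟨_, ⟨n, rfl⟩, k, hk, rfl⟩ := mem_sup_of_normal_right.mp hx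
        exact ⟨n, ⟨k, hk⟩, by ext; simp⟩
  exact isNoetherianRing_of_surjective _ _
    (MonoidAlgebra.mapDomainRingEquiv ℤ (Subgroup.topEquiv (G := G))).toRingHom
    (MonoidAlgebra.mapDomainRingEquiv ℤ (Subgroup.topEquiv (G := G))).surjective

/-! ### Resolutions by finitely generated projective modules -/

namespace ModuleCat

variable {R : Type u} [Ring R] [IsNoetherianRing R]

/-- A morphism with finite source extends to an exact sequence `P ⟶ X ⟶ Y` with `P` finite and free:
its kernel is finitely generated because the ring is Noetherian. -/
theorem exists_finite_projective_exact {X Y : ModuleCat.{u} R} (f : X ⟶ Y) [Module.Finite R X] :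
    ∃ (P : ModuleCat.{u} R) (_ : Module.Finite R P) (_ : Projective P) (d : P ⟶ X) (w : d ≫ f = 0),
      (ShortComplex.mk d f w).Exact := by
  obtain ⟨n, g, hg⟩ := Module.Finite.exists_fin' R (LinearMap.ker f.hom)
  refine ⟨of R (Fin n → R), inferInstanceAs (Module.Finite R (Fin n → R)),
    (IsProjective.iff_projective (R := R) (Fin n → R)).mp inferInstance,
    ofHom ((LinearMap.ker f.hom).subtype ∘ₗ g), ?_, ?_⟩
  · ext x
    exact (g _).2
  · rw [ShortComplex.moduleCat_exact_iff]
    intro x hx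
    obtain ⟨y, hy⟩ := hg ⟨x, hx⟩
    exact ⟨y, congrArg Subtype.val hy⟩

variable (R) in
/-- A linear map with finitely generated source: one step in the construction of a resolution. -/
structure FiniteHom where
  /-- The source. -/
  src : ModuleCat.{u} R
  /-- The target. -/
  tgt : ModuleCat.{u} R
  /-- The map. -/
  hom : src ⟶ tgt
  finite : Module.Finite R src

namespace FiniteHom

/-- A finite projective module mapping onto the kernel of the given map. -/
noncomputable def next (s : FiniteHom R) : FiniteHom R :=
  have := s.finite
  { src := (exists_finite_projective_exact s.hom).choose
    tgt := s.src
    hom := (exists_finite_projective_exact s.hom).choose_spec.choose_spec.choose_spec.choose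
    finite := (exists_finite_projective_exact s.hom).choose_spec.choose }

theorem projective_next (s : FiniteHom R) : Projective s.next.src :=
  have := s.finite
  (exists_finite_projective_exact s.hom).choose_spec.choose_spec.choose

theorem next_hom_comp (s : FiniteHom R) : (s.next.hom : s.next.src ⟶ s.src) ≫ s.hom = 0 :=
  have := s.finite
  (exists_finite_projective_exact s.hom).choose_spec.choose_spec.choose_spec.choose_spec.choose

theorem exact_next (s : FiniteHom R) :
    (ShortComplex.mk (s.next.hom : s.next.src ⟶ s.src) s.hom s.next_hom_comp).Exact :=
  have := s.finite
  (exists_finite_projective_exact s.hom).choose_spec.choose_spec.choose_spec.choose_spec.choose_spec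

/-- The maps of a resolution of `M`, preceded by the zero map from `M`. -/
noncomputable def sequence (M : ModuleCat.{u} R) [h : Module.Finite R M] : ℕ → FiniteHom R
  | 0 => ⟨M, M, 0, h⟩
  | n + 1 => (sequence M n).next

/-- The complex of finite projective modules given by `sequence`, without the term `M`. -/
noncomputable def resolutionComplex (M : ModuleCat.{u} R) [Module.Finite R M] :
    ChainComplex (ModuleCat.{u} R) ℕ :=
  ChainComplex.of (fun n => (sequence M (n + 1)).src) (fun n => (sequence M (n + 2)).hom)
    fun n => (sequence M (n + 2)).next_hom_comp

end FiniteHom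

theorem FiniteHom.resolutionComplex_d (M : ModuleCat.{u} R) [Module.Finite R M] (n : ℕ) :
    (resolutionComplex M).d (n + 1) n = (sequence M (n + 2)).hom :=
  ChainComplex.of_d (fun n => (sequence M (n + 1)).src) (fun n => (sequence M (n + 2)).hom) n

open FiniteHom in
/-- Over a Noetherian ring, a finitely generated module has a resolution by finitely generated
projective modules. -/
theorem exists_projectiveResolution_finite (M : ModuleCat.{u} R) [Module.Finite R M] :
    ∃ F : ProjectiveResolution M, ∀ i, Module.Finite R (F.complex.X i) := by
  let f : (sequence M 1).src ⟶ M := (sequence M 1).hom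
  have hf : (resolutionComplex M).d 1 0 ≫ f = 0 := by
    rw [resolutionComplex_d]
    exact (sequence M 1).next_hom_comp
  have hepi : Epi f := (ShortComplex.exact_iff_epi _ rfl).mp (sequence M 0).exact_next
  refine ⟨{
    complex := resolutionComplex M
    projective := fun n => (sequence M n).projective_next
    π := (ChainComplex.toSingle₀Equiv _ _).symm ⟨f, hf⟩
    quasiIso := ⟨fun n => ?_⟩ }, fun i => (sequence M (i + 1)).finite⟩
  cases n with
  | zero =>
    rw [ChainComplex.quasiIsoAt₀_iff, ShortComplex.quasiIso_iff_of_zeros']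
    · refine (ShortComplex.exact_and_epi_g_iff_of_iso ?_).2 ⟨(sequence M 1).exact_next, hepi⟩
      exact ShortComplex.isoMk (Iso.refl _) (Iso.refl _) (Iso.refl _)
        ((Category.id_comp _).trans
          ((resolutionComplex_d M 0).symm.trans (Category.comp_id _).symm))
        ((Category.id_comp _).trans
          ((ChainComplex.toSingle₀Equiv_symm_apply_f_zero (C := resolutionComplex M) f hf).symm.trans
            (Category.comp_id _).symm))
    all_goals rfl
  | succ n =>
    rw [quasiIsoAt_iff_exactAt']
    · rw [HomologicalComplex.exactAt_iff' _ (n + 1 + 1) (n + 1) n (by simp) (by simp)]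
      refine (ShortComplex.exact_iff_of_iso ?_).mpr (sequence M (n + 2)).exact_next
      exact ShortComplex.isoMk (Iso.refl _) (Iso.refl _) (Iso.refl _)
        ((Category.id_comp _).trans
          ((resolutionComplex_d M (n + 1)).symm.trans (Category.comp_id _).symm))
        ((Category.id_comp _).trans
          ((resolutionComplex_d M n).symm.trans (Category.comp_id _).symm))
    · apply ChainComplex.exactAt_succ_single_obj

end ModuleCat

instance TrivialZ.finite (G : Type u) [Group G] : Module.Finite (ZGroupRing G) (TrivialZ G) :=
  have : Module.Finite ℤ (TrivialZ G) :=
    .of_surjective (AddEquiv.ulift.symm : ℤ ≃+ ULift.{u} ℤ).toAddMonoidHom.toIntLinearMap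
      (AddEquiv.ulift.symm : ℤ ≃+ ULift.{u} ℤ).surjective
  .of_restrictScalars_finite ℤ _ _

/-! ### The mean ergodic theorem in `l^p(G)` -/

namespace LpHomology

section MeanErgodic

variable {p : ℝ≥0∞} [Fact (1 ≤ p)] {G : Type u} [Group G]

open scoped Classical in
theorem translation_single (g x : G) (a : ℂ) :
    translation p G g (lp.single (E := fun _ : G => ℂ) p x a) =
      lp.single (E := fun _ : G => ℂ) p (g * x) a := by
  ext y
  change lp.single (E := fun _ : G => ℂ) p x a (g⁻¹ * y) = _
  rw [lp.single_apply, lp.single_apply, Pi.single_apply, Pi.single_apply]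
  simp only [inv_mul_eq_iff_eq_mul]

instance : SMulCommClass (ZGroupRing G) ℂ (LpGroup p G) where
  smul_comm r c f := by
    induction r using MonoidAlgebra.induction_linear with
    | zero => simp
    | add r s hr hs => simp only [add_smul, hr, hs, smul_add]
    | single g n =>
      rw [single_smul, single_smul, smul_comm c n]
      rfl

/-- Multiplication by a central element of `G`, as a `ℤ[G]`-linear map. -/
noncomputable def centralMul {z : G} (hz : z ∈ Subgroup.center G) (M : Type v) [AddCommGroup M]
    [Module (ZGroupRing G) M] : Module.End (ZGroupRing G) M where
  toFun m := MonoidAlgebra.of ℤ G z • m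
  map_add' := smul_add _
  map_smul' r m := by
    rw [RingHom.id_apply, smul_smul, smul_smul,
      (MonoidAlgebra.of_commute (fun g => (Subgroup.mem_center_iff.mp hz g).symm) r).eq]

variable {z : G} (hz : z ∈ Subgroup.center G)

theorem centralMul_apply {M : Type v} [AddCommGroup M] [Module (ZGroupRing G) M] (m : M) :
    centralMul hz M m = MonoidAlgebra.of ℤ G z • m := rfl

theorem centralMul_lp_apply (f : LpGroup p G) :
    centralMul hz (LpGroup p G) f = translation p G z f := by
  rw [centralMul_apply, MonoidAlgebra.of_apply, single_smul, one_zsmul]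

theorem centralMul_lp_pow_apply (n : ℕ) (f : LpGroup p G) :
    (centralMul hz (LpGroup p G) ^ n) f = translation p G (z ^ n) f := by
  induction n with
  | zero => simp
  | succ n ih =>
    rw [pow_succ', Module.End.mul_apply, ih, centralMul_lp_apply, pow_succ', map_mul]
    rfl

variable (p) in
/-- The averages `(1 + z + ⋯ + z ^ (N - 1)) / N`, as `ℤ[G]`-linear operators of `l^p(G)`. -/
noncomputable def average (N : ℕ) : Module.End (ZGroupRing G) (LpGroup p G) :=
  (N : ℂ)⁻¹ • ∑ k ∈ Finset.range N, centralMul hz (LpGroup p G) ^ k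

variable (p) in
/-- The quotient of `1 - average p hz N` by `1 - z`. -/
noncomputable def averageQuotient (N : ℕ) : Module.End (ZGroupRing G) (LpGroup p G) :=
  (N : ℂ)⁻¹ • ∑ k ∈ Finset.range N, ∑ j ∈ Finset.range k, centralMul hz (LpGroup p G) ^ j

theorem one_sub_centralMul_mul_averageQuotient {N : ℕ} (hN : N ≠ 0) :
    (1 - centralMul hz (LpGroup p G)) * averageQuotient p hz N = 1 - average p hz N := by
  have hN' : (N : ℂ) ≠ 0 := Nat.cast_ne_zero.mpr hN
  have hsmul (c : ℂ) (T : Module.End (ZGroupRing G) (LpGroup p G)) :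
      (1 - centralMul hz (LpGroup p G)) * (c • T) =
        c • ((1 - centralMul hz (LpGroup p G)) * T) := LinearMap.ext fun f => by
    simp only [Module.End.mul_apply, LinearMap.sub_apply, LinearMap.smul_apply, smul_sub,
      Module.End.one_apply, centralMul_apply, smul_comm _ c]
  rw [averageQuotient, average, hsmul, Finset.mul_sum]
  simp only [mul_neg_geom_sum]
  rw [Finset.sum_sub_distrib, smul_sub, Finset.sum_const, Finset.card_range,
    ← Nat.cast_smul_eq_nsmul ℂ, smul_smul, inv_mul_cancel₀ hN', one_smul]

theorem average_apply (N : ℕ) (f : LpGroup p G) :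
    average p hz N f = birkhoffAverage ℂ (translation p G z) id N f := by
  rw [average, birkhoffAverage, birkhoffSum, LinearMap.smul_apply, LinearMap.sum_apply]
  congr 1
  refine Finset.sum_congr rfl fun k _ => ?_
  rw [centralMul_lp_pow_apply, map_pow, id, Module.End.pow_apply]

open scoped Classical in
/-- The average of a point mass `a` consists of `N` disjoint masses `a / N`, of norm
`N ^ (1 / p - 1) * ‖a‖`. -/
theorem tendsto_average_single (hz0 : orderOf z = 0) (hp : 1 < p) (hp_top : p ≠ ∞) (x : G) (a : ℂ) :
    Tendsto (fun N => average p hz N (lp.single (E := fun _ : G => ℂ) p x a)) atTop (𝓝 0) := by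
  have hp1 : 1 < p.toReal := by
    simpa using ENNReal.toReal_strict_mono hp_top hp
  have hp0 : 0 < p.toReal := one_pos.trans hp1
  have hinj : Function.Injective fun k : ℕ => z ^ k * x := fun k l h =>
    injective_pow_iff_not_isOfFinOrder.mpr (orderOf_eq_zero_iff.mp hz0) (mul_right_cancel h)
  have hnorm : ∀ N : ℕ, ‖average p hz N (lp.single (E := fun _ : G => ℂ) p x a)‖ =
      (N : ℝ)⁻¹ * ((N : ℝ) ^ p.toReal⁻¹ * ‖a‖) := by
    intro N
    have h1 : ∑ k ∈ Finset.range N, (centralMul hz (LpGroup p G) ^ k)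
        (lp.single (E := fun _ : G => ℂ) p x a) =
        ∑ y ∈ (Finset.range N).image (fun k => z ^ k * x),
          lp.single (E := fun _ : G => ℂ) p y a := by
      rw [Finset.sum_image hinj.injOn]
      refine Finset.sum_congr rfl fun k _ => ?_
      rw [centralMul_lp_pow_apply, translation_single]
    have h2 := lp.norm_sum_single (E := fun _ : G => ℂ) hp0 (fun _ => a)
      ((Finset.range N).image fun k => z ^ k * x)
    rw [Finset.sum_const, Finset.card_image_of_injective _ hinj, Finset.card_range,
      nsmul_eq_mul] at h2
    rw [average, LinearMap.smul_apply, LinearMap.sum_apply, h1, norm_smul, norm_inv,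
      Complex.norm_natCast]
    congr 1
    rw [← Real.rpow_rpow_inv (norm_nonneg (∑ y ∈ _, _)) hp0.ne', h2,
      Real.mul_rpow (Nat.cast_nonneg N) (by positivity), Real.rpow_rpow_inv (norm_nonneg a) hp0.ne']
  rw [tendsto_zero_iff_norm_tendsto_zero]
  have hlim : Tendsto (fun N : ℕ => (N : ℝ) ^ (-(1 - p.toReal⁻¹)) * ‖a‖) atTop (𝓝 0) := by
    have h := (tendsto_rpow_neg_atTop (sub_pos.mpr (inv_lt_one_of_one_lt₀ hp1))).comp
      tendsto_natCast_atTop_atTop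
    simpa using h.mul_const ‖a‖
  refine hlim.congr' ?_
  filter_upwards [eventually_gt_atTop 0] with N hN
  have hN' : (0 : ℝ) < N := Nat.cast_pos.mpr hN
  rw [hnorm, ← mul_assoc, ← Real.rpow_neg_one (N : ℝ), ← Real.rpow_add hN', neg_sub, sub_eq_neg_add]

/-- The mean ergodic theorem for translation by a central element of infinite order: the averages
have norm at most `1`, hence it suffices to consider point masses. -/
theorem tendsto_average (hz0 : orderOf z = 0) (hp : 1 < p) (hp_top : p ≠ ∞) (f : LpGroup p G) :
    Tendsto (fun N => average p hz N f) atTop (𝓝 0) := by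
  classical
  have hlip : LipschitzWith 1 (translation p G z) :=
    AddMonoidHomClass.lipschitz_of_bound_nnnorm _ 1 fun f => by
      rw [one_mul, ← NNReal.coe_le_coe, coe_nnnorm, coe_nnnorm, norm_translation]
  have hclosed : IsClosed {f : LpGroup p G | Tendsto (fun N => average p hz N f) atTop (𝓝 0)} := by
    simp only [average_apply]
    exact isClosed_setOfPred_tendsto_birkhoffAverage ℂ hlip uniformContinuous_id continuous_const
  refine hclosed.mem_of_tendsto (lp.hasSum_single hp_top f) (.of_forall fun s => ?_)
  simp only [Set.mem_ofPred_eq, map_sum]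
  simpa using tendsto_finsetSum s fun x _ => tendsto_average_single hz hz0 hp hp_top x (f x)

end MeanErgodic

end LpHomology

namespace LpHomology

/-! ### Functoriality of the tensor product with `l^p(G)` -/

section Tensor

variable {p : ℝ≥0∞} [Fact (1 ≤ p)] {G : Type u} [Group G]
variable {M N K : Type v} [AddCommGroup M] [Module (ZGroupRing G) M]
  [AddCommGroup N] [Module (ZGroupRing G) N] [AddCommGroup K] [Module (ZGroupRing G) K]

theorem LpTensor.induction_on {P : LpTensor p G M → Prop} (c : LpTensor p G M) (zero : P 0)
    (tmul : ∀ m f, P (tmul p m f)) (add : ∀ c d, P c → P d → P (c + d)) : P c := by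
  obtain ⟨c, rfl⟩ := QuotientAddGroup.mk'_surjective _ c
  induction c using TensorProduct.induction_on with
  | zero => exact zero
  | tmul m f => exact tmul m f
  | add c d hc hd => exact add _ _ hc hd

theorem LpTensor.addHom_ext {A : Type*} [AddCommGroup A] {φ ψ : LpTensor p G M →+ A}
    (h : ∀ m f, φ (tmul p m f) = ψ (tmul p m f)) : φ = ψ :=
  AddMonoidHom.ext fun c => LpTensor.induction_on (P := fun c => φ c = ψ c) c
    ((map_zero φ).trans (map_zero ψ).symm) h fun c d hc hd => by rw [map_add, map_add, hc, hd]

theorem tensorMap_add (d d' : M →ₗ[ZGroupRing G] N) :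
    tensorMap p (d + d') = tensorMap p d + tensorMap p d' :=
  LpTensor.addHom_ext fun m f => tmul_add_left (d m) (d' m) f

theorem tensorMap_id : tensorMap p (LinearMap.id : M →ₗ[ZGroupRing G] M) = AddMonoidHom.id _ :=
  LpTensor.addHom_ext fun _ _ => rfl

theorem tensorMap_comp (e : N →ₗ[ZGroupRing G] K) (d : M →ₗ[ZGroupRing G] N) :
    tensorMap p (e ∘ₗ d) = (tensorMap p e).comp (tensorMap p d) :=
  LpTensor.addHom_ext fun _ _ => rfl

variable (M) in
/-- The map `1 ⊗ T` of `M ⊗_{ℤ[G]} l^p(G)` induced by a `ℤ[G]`-linear operator `T` of `l^p(G)`. -/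
noncomputable def tensorMapRight (T : Module.End (ZGroupRing G) (LpGroup p G)) :
    LpTensor p G M →+ LpTensor p G M :=
  QuotientAddGroup.map (tensorRelations p G M) (tensorRelations p G M)
    (TensorProduct.map LinearMap.id T.toAddMonoidHom.toIntLinearMap).toAddMonoidHom (by
      refine (AddSubgroup.closure_le _).mpr ?_
      rintro _ ⟨g, m, f, rfl⟩
      refine AddSubgroup.subset_closure ⟨g, m, T f, ?_⟩
      simp [-MonoidAlgebra.of_apply])

theorem tensorMapRight_tmul (T : Module.End (ZGroupRing G) (LpGroup p G)) (m : M)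
    (f : LpGroup p G) : tensorMapRight M T (tmul p m f) = tmul p m (T f) := rfl

theorem tensorMapRight_one :
    tensorMapRight M (1 : Module.End (ZGroupRing G) (LpGroup p G)) = AddMonoidHom.id _ :=
  LpTensor.addHom_ext fun _ _ => rfl

theorem tensorMapRight_sub (S T : Module.End (ZGroupRing G) (LpGroup p G)) :
    tensorMapRight M (S - T) = tensorMapRight M S - tensorMapRight M T :=
  LpTensor.addHom_ext fun m f => map_sub (tmul p m) (S f) (T f)

theorem tensorMapRight_mul (S T : Module.End (ZGroupRing G) (LpGroup p G)) :
    tensorMapRight M (S * T) = (tensorMapRight M S).comp (tensorMapRight M T) :=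
  LpTensor.addHom_ext fun _ _ => rfl

theorem tensorMap_tensorMapRight (d : M →ₗ[ZGroupRing G] N)
    (T : Module.End (ZGroupRing G) (LpGroup p G)) (c : LpTensor p G M) :
    tensorMap p d (tensorMapRight M T c) = tensorMapRight N T (tensorMap p d c) :=
  DFunLike.congr_fun (show (tensorMap p d).comp (tensorMapRight M T) =
    (tensorMapRight N T).comp (tensorMap p d) from LpTensor.addHom_ext fun _ _ => rfl) c

/-- Because of the right module structure `m g = g⁻¹ m`, multiplication by `z` on the left factor is
multiplication by `z⁻¹` on the right one. -/
theorem tensorMap_centralMul {z : G} (hz : z ∈ Subgroup.center G) :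
    tensorMap p (centralMul hz M) = tensorMapRight M (centralMul (inv_mem hz) (LpGroup p G)) :=
  LpTensor.addHom_ext fun m f => tmul_of_smul z m f

theorem tendsto_tensorMapRight {T : ℕ → Module.End (ZGroupRing G) (LpGroup p G)}
    (hT : ∀ f, Tendsto (fun n => T n f) atTop (𝓝 0)) (c : LpTensor p G M) :
    Tendsto (fun n => tensorMapRight M (T n) c) atTop (𝓝 0) := by
  induction c using LpTensor.induction_on with
  | zero => simpa only [map_zero] using tendsto_const_nhds
  | tmul m f =>
    simpa [tensorMapRight_tmul, Function.comp_def] using ((continuous_tmul m).tendsto 0).comp (hT f)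
  | add c d hc hd => simpa only [map_add, add_zero] using hc.add hd

end Tensor

theorem tendsto_comp_hom {p : ℝ≥0∞} [Fact (1 ≤ p)] {G : Type u} [Group G] {M : Type v}
    [AddCommGroup M] [Module (ZGroupRing G) M]
    {T : ℕ → Module.End (ZGroupRing G) (LpGroup p G)}
    (hT : ∀ f, Tendsto (fun n => T n f) atTop (𝓝 0)) (φ : LpHom p G M) :
    Tendsto (fun n => (T n ∘ₗ φ : LpHom p G M)) atTop (𝓝 0) := by
  rw [nhds_induced, tendsto_comap_iff, tendsto_pi_nhds]
  exact fun m => hT (φ m)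

/-! ### Central elements act on resolutions homotopically trivially -/

section Homotopy

variable {G : Type u} [Group G] (F : GroupResolution G) {z : G} (hz : z ∈ Subgroup.center G)

/-- Multiplication by a central element on a resolution, as a chain map. -/
noncomputable def centralMulChainMap : F.complex ⟶ F.complex where
  f i := ModuleCat.ofHom (centralMul hz (F.complex.X i))
  comm' i j _ := by
    ext x
    exact map_smul (F.complex.d i j).hom (MonoidAlgebra.of ℤ G z) x

theorem of_smul_trivialZ (g : G) (x : TrivialZ G) : MonoidAlgebra.of ℤ G g • x = x := by
  change (MonoidAlgebra.lift ℤ (Module.End ℤ (TrivialZ G)) G 1 (MonoidAlgebra.of ℤ G g)) x = x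
  rw [MonoidAlgebra.lift_of]
  rfl

/-- Multiplication by `z` lifts the identity of the trivial module `ℤ`, hence it is chain homotopic
to the identity. -/
noncomputable def homotopyCentralMul : Homotopy (centralMulChainMap F hz) (𝟙 F.complex) :=
  ProjectiveResolution.liftHomotopy (𝟙 _) _ _ (by
    ext x
    exact (map_smul (F.π.f 0).hom _ _).trans (of_smul_trivialZ z _)) (by simp)

/-- The null-homotopy `h` of `z - 1`, spelled out in degree `0` and in positive degrees. -/
theorem exists_homotopy_centralMul : ∃ h : ∀ i, F.complex.X i →ₗ[ZGroupRing G] F.complex.X (i + 1),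
    centralMul hz (F.complex.X 0) = (F.complex.d 1 0).hom ∘ₗ h 0 + LinearMap.id ∧
    ∀ i, centralMul hz (F.complex.X (i + 1)) =
      h i ∘ₗ (F.complex.d (i + 1) i).hom + (F.complex.d (i + 2) (i + 1)).hom ∘ₗ h (i + 1) +
        LinearMap.id := by
  let H := homotopyCentralMul F hz
  refine ⟨fun i => (H.hom i (i + 1)).hom, ?_, fun i => ?_⟩
  · have h := H.comm 0
    rw [Homotopy.dNext_zero_chainComplex, zero_add, Homotopy.prevD_chainComplex] at h
    exact congrArg ModuleCat.Hom.hom h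
  · have h := H.comm (i + 1)
    rw [Homotopy.dNext_succ_chainComplex, Homotopy.prevD_chainComplex] at h
    exact congrArg ModuleCat.Hom.hom h

end Homotopy

/-! ### Cycles are limits of boundaries -/

section Vanishing

variable {p : ℝ≥0∞} [Fact (1 ≤ p)] {G : Type u} [Group G] (F : GroupResolution G) {z : G}
  (hz : z ∈ Subgroup.center G)

include hz in
theorem tensorMap_centralMul_sub_mem_boundaries (i : ℕ) {c : LpTensor p G (F.complex.X i)}
    (hc : c ∈ cycles p F i) :
    tensorMap p (centralMul hz (F.complex.X i)) c - c ∈ boundaries p F i := by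
  obtain ⟨h, h0, hs⟩ := exists_homotopy_centralMul F hz
  cases i with
  | zero =>
    refine ⟨tensorMap p (h 0) c, ?_⟩
    rw [h0, tensorMap_add, tensorMap_comp, tensorMap_id]
    exact (add_sub_cancel_right _ _).symm
  | succ i =>
    refine ⟨tensorMap p (h (i + 1)) c, ?_⟩
    have hc' : tensorMap p (F.complex.d (i + 1) i).hom c = 0 := hc
    rw [hs, tensorMap_add, tensorMap_add, tensorMap_comp, tensorMap_comp, tensorMap_id]
    simp [hc']

include hz in
theorem comp_centralMul_sub_mem_coboundaries (i : ℕ) {φ : LpHom p G (F.complex.X i)}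
    (hφ : φ ∈ cocycles p F i) :
    φ ∘ₗ centralMul hz (F.complex.X i) - φ ∈ coboundaries p F i := by
  obtain ⟨h, h0, hs⟩ := exists_homotopy_centralMul F hz
  have hφ' : φ ∘ₗ (F.complex.d (i + 1) i).hom = 0 := hφ
  cases i with
  | zero =>
    rw [h0, LinearMap.comp_add, ← LinearMap.comp_assoc, hφ', LinearMap.zero_comp, zero_add,
      LinearMap.comp_id, sub_self]
    exact zero_mem _
  | succ i =>
    refine ⟨φ ∘ₗ h i, ?_⟩
    rw [hs, LinearMap.comp_add, LinearMap.comp_add, ← LinearMap.comp_assoc (h (i + 1)), hφ',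
      LinearMap.zero_comp, add_zero, LinearMap.comp_id, add_sub_cancel_right]
    rfl

include hz in
/-- A cycle `c` is the limit of `c - T_N c`, where `T_N` averages over powers of `z⁻¹`; and
`c - T_N c = (1 - z⁻¹) S_N c` is a boundary, as `S_N c` is a cycle. -/
theorem cycles_le_closure_boundaries (hz0 : orderOf z = 0) (hp : 1 < p) (hp_top : p ≠ ∞) (i : ℕ) :
    cycles p F i ≤ (boundaries p F i).topologicalClosure := by
  intro c hc
  have hlim := (tendsto_const_nhds (x := c)).sub (tendsto_tensorMapRight
    (tendsto_average (inv_mem hz) (by rwa [orderOf_inv]) hp hp_top) c)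
  rw [sub_zero] at hlim
  refine mem_closure_of_tendsto hlim ?_
  filter_upwards [eventually_ne_atTop 0] with N hN
  have hS : tensorMapRight _ (averageQuotient p (inv_mem hz) N) c ∈ cycles p F i := by
    cases i with
    | zero => exact AddSubgroup.mem_top _
    | succ i =>
      have hc' : tensorMap p (F.complex.d (i + 1) i).hom c = 0 := hc
      exact (tensorMap_tensorMapRight _ _ _).trans ((congrArg _ hc').trans (map_zero _))
  have h1 := congrArg (fun T => tensorMapRight (F.complex.X i) T c)
    (one_sub_centralMul_mul_averageQuotient (p := p) (inv_mem hz) hN)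
  simp only [tensorMapRight_mul, tensorMapRight_sub, tensorMapRight_one] at h1
  rw [← tensorMap_centralMul hz] at h1
  have h2 := neg_mem (tensorMap_centralMul_sub_mem_boundaries F hz i hS)
  rw [neg_sub] at h2
  exact (show _ = c - _ from h1) ▸ h2

theorem averageQuotient_comp_sub {M : Type v} [AddCommGroup M] [Module (ZGroupRing G) M] {N : ℕ}
    (hN : N ≠ 0) (φ : LpHom p G M) :
    averageQuotient p hz N ∘ₗ φ - (averageQuotient p hz N ∘ₗ φ) ∘ₗ centralMul hz M =
      φ - average p hz N ∘ₗ φ := by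
  ext1 m
  have h := LinearMap.congr_fun (one_sub_centralMul_mul_averageQuotient (p := p) hz hN) (φ m)
  simp only [Module.End.mul_apply, LinearMap.sub_apply, Module.End.one_apply] at h
  simp only [LinearMap.sub_apply, LinearMap.comp_apply, ← h, centralMul_apply, map_smul]

include hz in
/-- The argument of `cycles_le_closure_boundaries`, with the averages applied to the values of a
cocycle. -/
theorem cocycles_le_closure_coboundaries (hz0 : orderOf z = 0) (hp : 1 < p) (hp_top : p ≠ ∞)
    (i : ℕ) : cocycles p F i ≤ (coboundaries p F i).topologicalClosure := by
  intro φ hφ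
  have hlim := (tendsto_const_nhds (x := φ)).sub (tendsto_comp_hom
    (tendsto_average hz hz0 hp hp_top) φ)
  rw [sub_zero] at hlim
  refine mem_closure_of_tendsto hlim ?_
  filter_upwards [eventually_ne_atTop 0] with N hN
  have hS : averageQuotient p hz N ∘ₗ φ ∈ cocycles p F i := by
    have hφ' : φ ∘ₗ (F.complex.d (i + 1) i).hom = 0 := hφ
    change (averageQuotient p hz N ∘ₗ φ) ∘ₗ (F.complex.d (i + 1) i).hom = 0
    rw [LinearMap.comp_assoc, hφ', LinearMap.comp_zero]
  have h2 := neg_mem (comp_centralMul_sub_mem_coboundaries F hz i hS)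
  rw [neg_sub] at h2
  change φ - average p hz N ∘ₗ φ ∈ coboundaries p F i
  rwa [averageQuotient_comp_sub hz hN] at h2

end Vanishing

end LpHomology

theorem AddSubgroup.subsingleton_quotient_addSubgroupOf {A : Type*} [AddGroup A]
    {H K : AddSubgroup A} (h : K ≤ H) : Subsingleton (K ⧸ H.addSubgroupOf K) := by
  rw [AddSubgroup.addSubgroupOf_eq_top.mpr h]
  exact QuotientAddGroup.subsingleton_quotient_top

theorem mainTheorem6 (p : ℝ≥0∞) [Fact (1 ≤ p)] (hp : 1 < p) (hp_top : p ≠ ∞)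
    (G : Type u) [Group G] [Infinite G] (hfg : Group.FG G) (hnil : Group.IsNilpotent G) :
    (∃ F : GroupResolution G, ∀ i : ℕ, Module.Finite (ZGroupRing G) (F.complex.X i)) ∧
    ∀ (F : GroupResolution G) (i : ℕ), Module.Finite (ZGroupRing G) (F.complex.X i) →
      Subsingleton (LpHomology.ReducedHomology p F i) ∧
      Subsingleton (LpHomology.ReducedCohomology p F i) := by
  constructor
  · have := Group.IsNilpotent.isNoetherianRing_monoidAlgebra G
    exact ModuleCat.exists_projectiveResolution_finite (R := ZGroupRing G) _
  · intro F i _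
    obtain ⟨z, hz, hz0⟩ := Group.IsNilpotent.exists_mem_center_orderOf_eq_zero G
    exact ⟨AddSubgroup.subsingleton_quotient_addSubgroupOf
        (LpHomology.cycles_le_closure_boundaries F hz hz0 hp hp_top i),
      AddSubgroup.subsingleton_quotient_addSubgroupOf
        (LpHomology.cocycles_le_closure_coboundaries F hz hz0 hp hp_top i)⟩
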